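/- Let $N$ be a finite set of agents and $\mathcal O$ a finite nonempty set of objects. An allocation is a map $x:N\to\mathcal O$, $i\mapsto x_i$; a constraint is a nonempty set $C\subseteq\mathcal O^N$ of allocations, called feasible. For allocations $x,y$ put $d(x,y)=\{i\in N: x_i\neq y_i\}$. A preference profile $\succ=(\succ_i)_{i\in N}$ consists of a strict total order $\succ_i$ on $\mathcal O$ for each agent $i$; $a\succsim_i b$ means $a\succ_i b$ or $a=b$. A local compromiser assignment for $C$ is a map $\alpha:\mathcal O^N\to 2^N$ with $\alpha(x)\neq\emptyset$ for every $x\notin C$ and $\alpha(x)=\emptyset$ for every $x\in C$. The local priority algorithm for $\alpha$ at a profile $\succ$ starts at the allocation $x^0$ in which every agent gets her most preferred object. If the current allocation $x^t$ is feasible, it stops and returns $x^t$. If $x^t$ is infeasible and some $k\in\alpha(x^t)$ has no object strictly worse than $x^t_k$, it stops and fails. Otherwise $x^{t+1}_k$ is, for each $k\in\alpha(x^t)$, the $\succ_k$-best object strictly worse than $x^t_k$, and $x^{t+1}_j=x^t_j$ for $j\notin\alpha(x^t)$. If the algorithm returns a feasible allocation at every profile, $\alpha$ is called implementable, and $LP_\alpha(\succ)$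 denotes the allocation returned at $\succ$. The assignment $\alpha$ is forward consistent if $d(x,y)\subseteq\alpha(x)$ implies $\alpha(x)\setminus d(x,y)\subseteq\alpha(y)$ for all allocations $x,y$. Infeasible allocations $x,y$ are $i$-connected under $\alpha$ if there are $p\ge 2$ and allocations $z^1,\dots,z^p$ with $z^1=x$, $z^p=y$, $d(z^1,z^2)=\{i\}$ and $d(z^l,z^{l+1})\subseteq\alpha(z^l)$ for all $l<p$, such that for no agent $j$ are there $r<s<t$ with $z^r_j=z^t_j\neq z^s_j$. The assignment $\alpha$ is backward consistent if, for every agent $i$ and all infeasible $x,y$ that are $i$-connected under $\alpha$, every allocation $x'$ with $d(x,x')\subseteq\alpha(y)$ and $i\notin d(x,x')$ satisfies $i\in\alpha(x')$. It is consistent if it is both forward and backward consistent. Proposition. Fix a constraint $C$ and an agent $i$. Let $\alpha$ and $\alpha'$ be two consistent, implementable local compromiser assignments for $C$ such that for every infeasible $x$: (1) for every $j\neq i$, if $j\in\alpha(x)$ then $j\in\alpha'(x)$; (2) if $i\in\alpha'(x)$ then $i\in\alpha(x)$. Then $LP_{\alpha'}(\succ)_i\succsim_i LP_\alpha(\succ)_i$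 for every preference profile $\succ$. -/

import Mathlib

namespace LocalPriority

/-- A strict preference on the set of objects `O`; `P.gt a b` means that `a` is ranked above `b`. -/
structure Preference (O : Type*) where
  gt : O → O → Prop
  isStrictTotalOrder : IsStrictTotalOrder O gt

namespace Preference

variable {O : Type*}

/-- Weak preference: `a` is ranked above `b`, or `a = b`. -/
def ge (P : Preference O) (a b : O) : Prop := P.gt a b ∨ a = b

/-- The strict lower contour set of `a`. -/
def lowerContour (P : Preference O) (a : O) : Set O := {b | P.gt a b}

/-- `a` is the most preferred element of `S`. -/
def IsBest (P : Preference O) (S : Set O) (a : O) : Prop :=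
  a ∈ S ∧ ∀ b ∈ S, P.ge a b

theorem exists_isBest [Finite O] (P : Preference O) {S : Set O} (hS : S.Nonempty) :
    ∃ a, P.IsBest S a := by
  have := P.isStrictTotalOrder
  have hwf : WellFounded P.gt := Finite.wellFounded_of_trans_of_irrefl P.gt
  refine ⟨hwf.min S hS, hwf.min_mem S hS, fun b hb => ?_⟩
  rcases trichotomous_of P.gt (hwf.min S hS) b with h | h | h
  · exact Or.inl h
  · exact Or.inr h
  · exact absurd h (hwf.not_lt_min S hb)

/-- The most preferred element of a nonempty set of objects. -/
noncomputable def argmax [Finite O] (P : Preference O) (S : Set O) (hS : S.Nonempty) : O :=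
  (P.exists_isBest hS).choose

end Preference

/-- An allocation gives every agent in `N` an object in `O`. -/
abbrev Allocation (N O : Type*) := N → O

/-- A preference profile gives every agent a strict preference over objects. -/
abbrev Profile (N O : Type*) := N → Preference O

variable {N O : Type*}

/-- The set of agents whose objects differ in `x` and `y`. -/
def diff (x y : Allocation N O) : Set N := {i | x i ≠ y i}

/-- `α` is a local compromiser assignment for the constraint `C` (the set of feasible
allocations): nonempty at every infeasible allocation, empty at every feasible one. -/
structure IsLocalCompromiserAssignment (C : Set (Allocation N O))
    (α : Allocation N O → Set N) : Prop where
  nonempty_of_infeasible : ∀ x, x ∉ C → (α x).Nonempty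
  eq_empty_of_feasible : ∀ x, x ∈ C → α x = ∅

open Classical in
/-- One update from an infeasible allocation `x`: every compromiser moves to her best object
strictly below the current one; the value is `none` if some compromiser has no such object. -/
noncomputable def update [Finite O] (α : Allocation N O → Set N) (P : Profile N O)
    (x : Allocation N O) : Option (Allocation N O) :=
  if h : ∀ k ∈ α x, ((P k).lowerContour (x k)).Nonempty then
    some fun j => if hj : j ∈ α x then (P j).argmax ((P j).lowerContour (x j)) (h j hj) else x j
  else none

open Classical in
/-- The state of the local priority algorithm after `t` updates. It starts at the allocation of
top choices and stays put once it is feasible; `none` is the failure symbol. -/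
noncomputable def run [Finite O] [Nonempty O] (C : Set (Allocation N O))
    (α : Allocation N O → Set N) (P : Profile N O) : ℕ → Option (Allocation N O)
  | 0 => some fun j => (P j).argmax Set.univ Set.univ_nonempty
  | t + 1 => (run C α P t).bind fun x => if x ∈ C then some x else update α P x

/-- The local priority algorithm at profile `P` stops and returns the feasible allocation `x`. -/
def Returns [Finite O] [Nonempty O] (C : Set (Allocation N O))
    (α : Allocation N O → Set N) (P : Profile N O) (x : Allocation N O) : Prop :=
  x ∈ C ∧ ∃ t, run C α P t = some x

/-- The local priority algorithm returns an allocation at every preference profile. -/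
def Implementable [Finite O] [Nonempty O] (C : Set (Allocation N O))
    (α : Allocation N O → Set N) : Prop :=
  ∀ P : Profile N O, ∃ x, Returns C α P x

/-- The local priority mechanism of an implementable assignment. -/
noncomputable def LP [Finite O] [Nonempty O] {C : Set (Allocation N O)}
    {α : Allocation N O → Set N} (h : Implementable C α) (P : Profile N O) : Allocation N O :=
  (h P).choose

def ForwardConsistent (α : Allocation N O → Set N) : Prop :=
  ∀ x y, diff x y ⊆ α x → α x \ diff x y ⊆ α y

/-- The sequence of objects `a 0, …, a p` never leaves an object and returns to it. -/
def AcyclicObjects (p : ℕ) (a : ℕ → O) : Prop :=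
  ¬ ∃ r s t, r < s ∧ s < t ∧ t ≤ p ∧ a r = a t ∧ a s ≠ a r

/-- The sequence of allocations `z 0, …, z p` is acyclic for every agent. -/
def AcyclicAllocations (p : ℕ) (z : ℕ → Allocation N O) : Prop :=
  ∀ j, AcyclicObjects p fun l => z l j

/-- `x` and `y` are `i`-connected under `α`, through the sequence `z 0, …, z p` with `1 ≤ p`. -/
def Connected (α : Allocation N O → Set N) (i : N) (x y : Allocation N O) : Prop :=
  ∃ (p : ℕ) (z : ℕ → Allocation N O), 1 ≤ p ∧ AcyclicAllocations p z ∧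
    z 0 = x ∧ z p = y ∧ diff (z 0) (z 1) = {i} ∧
    ∀ l < p, diff (z (l + 1)) (z l) ⊆ α (z l)

def BackwardConsistent (C : Set (Allocation N O)) (α : Allocation N O → Set N) : Prop :=
  ∀ i x y, x ∉ C → y ∉ C → Connected α i x y →
    ∀ x', diff x x' ⊆ α y → i ∉ diff x x' → i ∈ α x'

def Consistent (C : Set (Allocation N O)) (α : Allocation N O → Set N) : Prop :=
  ForwardConsistent α ∧ BackwardConsistent C α

end LocalPriority

/-!
Read one round of the algorithm as a step in which any set of current compromisers moves down.
Forward consistency makes steps confluent, so a feasible allocation reachable from the top choices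
is the outcome. Backward consistency lets agent `i`'s object be frozen along a path ending where `i`
compromises, and makes `i` keep compromising on an object while the others move. Hence, once `i`
compromises on an object, no report of hers can return that object: the mechanism is strategy-proof.

Now let `a` be what `i` gets under `α`, and let her rank `a` first. By strategy-proofness she still
gets `a` under `α`, so she never moves, and the same run is available under `α'`. Thus `a` is
what this report gives her under `α'`, and strategy-proofness of `α'` concludes.
-/

open Relation

namespace LocalPriority

namespace Preference

variable {O : Type*} (P : Preference O)

attribute [instance] isStrictTotalOrder

theorem ge_refl (a : O) : P.ge a a :=
  Or.inr rfl

theorem ge_trans {a b c : O} (hab : P.ge a b) (hbc : P.ge b c) : P.ge a c := by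
  rcases hab with hab | rfl
  · rcases hbc with hbc | rfl
    · exact Or.inl (trans_of P.gt hab hbc)
    · exact Or.inl hab
  · exact hbc

instance : Std.Refl P.ge := ⟨P.ge_refl⟩

instance : IsTrans O P.ge := ⟨fun _ _ _ => P.ge_trans⟩

theorem not_ge_of_gt {a b : O} (hab : P.gt a b) : ¬P.ge b a := by
  rintro (hba | rfl)
  · exact asymm_of P.gt hab hba
  · exact irrefl_of P.gt _ hab

theorem ge_or_gt (a b : O) : P.ge a b ∨ P.gt b a :=
  or_assoc.2 (trichotomous_of P.gt a b)

theorem ge_antisymm {a b : O} (hab : P.ge a b) (hba : P.ge b a) : a = b :=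
  hab.resolve_left fun h => P.not_ge_of_gt h hba

variable {P} in
theorem IsBest.unique {S : Set O} {a b : O} (ha : P.IsBest S a) (hb : P.IsBest S b) : a = b :=
  P.ge_antisymm (ha.2 b hb.1) (hb.2 a ha.1)

theorem isBest_argmax [Finite O] {S : Set O} (hS : S.Nonempty) : P.IsBest S (P.argmax S hS) :=
  (P.exists_isBest hS).choose_spec

theorem exists_isBest_univ (a : O) : ∃ Q : Preference O, Q.IsBest Set.univ a := by
  classical
  have hne : (Set.univ : Set O).Nonempty := ⟨a, Set.mem_univ a⟩
  have hwf : WellFounded (WellOrderingRel : O → O → Prop) := IsWellFounded.wf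
  let b : O := hwf.min Set.univ hne
  let e : O ≃ O := Equiv.swap a b
  let Q : Preference O :=
    ⟨Function.onFun WellOrderingRel e, e.injective.isStrictTotalOrder_onFun (r := WellOrderingRel)⟩
  refine ⟨Q, Set.mem_univ a, fun c _ => (Q.ge_or_gt a c).resolve_right fun hca => ?_⟩
  have hcb : WellOrderingRel (e c) (e a) := hca
  rw [Equiv.swap_apply_left] at hcb
  exact hwf.not_lt_min Set.univ (Set.mem_univ _) hcb

end Preference

variable {N O : Type*} {C : Set (Allocation N O)} {α α' : Allocation N O → Set N}
  {P Q : Profile N O} {i k : N}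

theorem IsLocalCompromiserAssignment.notMem_of_mem (hα : IsLocalCompromiserAssignment C α)
    {x : Allocation N O} (hi : i ∈ α x) : x ∉ C :=
  fun hx => Set.notMem_empty i (hα.eq_empty_of_feasible x hx ▸ hi)

theorem mem_diff {x y : Allocation N O} : i ∈ diff x y ↔ x i ≠ y i :=
  Iff.rfl

theorem diff_comm (x y : Allocation N O) : diff x y = diff y x :=
  Set.ext fun _ => ne_comm

theorem diff_update_subset [DecidableEq N] (x : Allocation N O) (i : N) (a : O) :
    diff x (Function.update x i a) ⊆ {i} := by
  intro j hj
  by_contra hji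
  exact hj (Function.update_of_ne hji a x).symm

theorem diff_update_of_ne [DecidableEq N] {x : Allocation N O} {a : O} (ha : x i ≠ a) :
    diff x (Function.update x i a) = {i} := by
  refine (diff_update_subset x i a).antisymm (Set.singleton_subset_iff.2 ?_)
  rwa [mem_diff, Function.update_self]

/-- Some, not necessarily all, of the compromisers at `x` move to their best objects below the
current ones, which leads to `y`. A round of the algorithm is the case where all of them move.
The movers are not recorded, as they are exactly the agents in `diff x y`. -/
def Step (α : Allocation N O → Set N) (P : Profile N O) (x y : Allocation N O) : Prop :=
  ∀ j ∈ diff x y, j ∈ α x ∧ (P j).IsBest ((P j).lowerContour (x j)) (y j)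

section Step

variable {x y z : Allocation N O}

theorem Step.refl (x : Allocation N O) : Step α P x x :=
  fun _ hj => absurd rfl hj

theorem Step.diff_subset (h : Step α P x y) : diff x y ⊆ α x :=
  fun j hj => (h j hj).1

theorem Step.ge (h : Step α P x y) (j : N) : (P j).ge (x j) (y j) := by
  by_cases hj : x j = y j
  · exact Or.inr hj
  · exact Or.inl (h j hj).2.1

theorem ge_of_reflTransGen_step (h : ReflTransGen (Step α P) x y) (j : N) :
    (P j).ge (x j) (y j) := by
  induction h with
  | refl => exact (P j).ge_refl _
  | tail _ hs ih => exact (P j).ge_trans ih (hs.ge j)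

theorem eq_of_reflTransGen_step_of_mem (hα : IsLocalCompromiserAssignment C α) (hx : x ∈ C)
    (h : ReflTransGen (Step α P) x y) : x = y := by
  induction h with
  | refl => rfl
  | tail _ hs ih =>
    subst ih
    exact funext fun j => not_not.1 fun hj => hα.notMem_of_mem (hs.diff_subset hj) hx

theorem Step.diamond (hf : ForwardConsistent α) (hy : Step α P x y) (hz : Step α P x z) :
    ∃ w, Step α P y w ∧ Step α P z w := by
  classical
  refine ⟨(diff x y).piecewise y z, fun j hj => ?_, fun j hj => ?_⟩
  · have hjy : j ∉ diff x y := fun h => hj (Set.piecewise_eq_of_mem _ y z h).symm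
    have hxy : x j = y j := not_not.1 hjy
    have hw : (diff x y).piecewise y z j = z j := Set.piecewise_eq_of_notMem _ y z hjy
    obtain ⟨hjα, hbest⟩ := hz j fun h => hj (by rw [hw, ← h, hxy])
    rw [hw, ← hxy]
    exact ⟨hf x y hy.diff_subset ⟨hjα, hjy⟩, hbest⟩
  · have hjy : j ∈ diff x y := by
      by_contra h
      exact hj (Set.piecewise_eq_of_notMem _ y z h).symm
    have hw : (diff x y).piecewise y z j = y j := Set.piecewise_eq_of_mem _ y z hjy
    obtain ⟨hjα, hbest⟩ := hy j hjy
    have hjz : j ∉ diff x z := fun h => hj (by rw [hw, hbest.unique (hz j h).2])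
    have hxz : x j = z j := not_not.1 hjz
    rw [hw, ← hxz]
    exact ⟨hf x z hz.diff_subset ⟨hjα, hjz⟩, hbest⟩

theorem join_reflTransGen_step (hf : ForwardConsistent α) (hy : ReflTransGen (Step α P) x y)
    (hz : ReflTransGen (Step α P) x z) : Join (ReflTransGen (Step α P)) y z := by
  refine church_rosser (fun _ _ _ hb hc => ?_) hy hz
  obtain ⟨w, hbw, hcw⟩ := Step.diamond hf hb hc
  exact ⟨w, .single hbw, .single hcw⟩

theorem Step.update_left_right [DecidableEq N] (hf : ForwardConsistent α) (h : Step α P x y)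
    (k : N) : Step α P x (Function.update x k (y k)) ∧ Step α P (Function.update x k (y k)) y := by
  have hleft : Step α P x (Function.update x k (y k)) := by
    intro j hj
    obtain rfl : j = k := diff_update_subset x k (y k) hj
    rw [mem_diff, Function.update_self] at hj
    rw [Function.update_self]
    exact h j hj
  refine ⟨hleft, fun j hj => ?_⟩
  have hjk : j ≠ k := by
    rintro rfl
    exact hj (Function.update_self j (y j) x)
  rw [mem_diff, Function.update_of_ne hjk] at hj
  rw [Function.update_of_ne hjk]
  exact ⟨hf x _ hleft.diff_subset ⟨(h j hj).1, fun hd => hjk (diff_update_subset x k _ hd)⟩,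
    (h j hj).2⟩

theorem exists_mem_of_gt {a : O} (h : ReflTransGen (Step α P) x y) (hx : (P i).ge (x i) a)
    (hy : (P i).gt a (y i)) : ∃ v, ReflTransGen (Step α P) x v ∧ v i = a ∧ i ∈ α v := by
  induction h with
  | refl => exact absurd hx ((P i).not_ge_of_gt hy)
  | @tail v w hxv hs ih =>
    rcases (P i).ge_or_gt (v i) a with hva | hav
    · have hi : i ∈ diff v w := fun hvw => (P i).not_ge_of_gt hy (hvw ▸ hva)
      obtain ⟨hiα, -, hbest⟩ := hs i hi
      exact ⟨v, hxv, hva.resolve_left fun h => (P i).not_ge_of_gt hy (hbest a h), hiα⟩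
    · exact ih hav

theorem reflTransGen_step_of_forall_mem (hαα' : ∀ x, ∀ j ≠ i, j ∈ α x → j ∈ α' x)
    (h : ReflTransGen (Step α P) x y) (hxy : x i = y i) : ReflTransGen (Step α' P) x y := by
  induction h using ReflTransGen.head_induction_on with
  | refl => exact .refl
  | @head x x' hs hx'y ih =>
    have hxx' : x i = x' i :=
      (P i).ge_antisymm (hs.ge i) (hxy ▸ ge_of_reflTransGen_step hx'y i)
    have hs' : Step α' P x x' := fun j hj =>
      ⟨hαα' x j (fun hji => hj (hji ▸ hxx')) (hs j hj).1, (hs j hj).2⟩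
    exact .head hs' (ih (hxx' ▸ hxy))

end Step

section Connected

theorem exists_seq_of_reflTransGen {β : Type*} {r : β → β → Prop} [Std.Refl r] {x y : β}
    (h : ReflTransGen r x y) :
    ∃ (n : ℕ) (z : ℕ → β), z 0 = x ∧ z n = y ∧ ∀ l, r (z l) (z (l + 1)) := by
  induction h using ReflTransGen.head_induction_on with
  | refl => exact ⟨0, fun _ => y, rfl, rfl, fun _ => refl_of r y⟩
  | @head x x' hs _ ih =>
    obtain ⟨n, z, rfl, hn, hz⟩ := ih
    exact ⟨n + 1, fun l => l.casesOn x z, rfl, hn, fun l => l.casesOn hs hz⟩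

instance : Std.Refl (Step α P) := ⟨Step.refl⟩

theorem acyclicAllocations_of_forall_step {z : ℕ → Allocation N O}
    (hz : ∀ l, Step α P (z l) (z (l + 1))) (p : ℕ) : AcyclicAllocations p z := by
  rintro j ⟨r, s, t, hrs, hst, -, hrt, hsr⟩
  have hanti {u v : ℕ} (huv : u ≤ v) : (P j).ge (z u j) (z v j) :=
    Nat.rel_of_forall_rel_succ_of_le (P j).ge (f := fun l => z l j) (fun l => (hz l).ge j) huv
  exact hsr ((P j).ge_antisymm ((P j).ge_trans (hanti hst.le) (Or.inr hrt.symm)) (hanti hrs.le))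

theorem connected_of_step {x x' y : Allocation N O} (hs : Step α P x x') (hk : diff x x' = {k})
    (h : ReflTransGen (Step α P) x' y) : Connected α k x y := by
  obtain ⟨n, z, rfl, hn, hz⟩ := exists_seq_of_reflTransGen h
  let w : ℕ → Allocation N O := fun l => l.casesOn x z
  have hw : ∀ l, Step α P (w l) (w (l + 1)) := fun l => l.casesOn hs hz
  refine ⟨n + 1, w, n.succ_pos, acyclicAllocations_of_forall_step hw _, rfl, hn, hk,
    fun l _ => ?_⟩
  rw [diff_comm]
  exact (hw l).diff_subset

theorem connected_update [DecidableEq N] {x : Allocation N O} {a : O} (hi : i ∈ α x)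
    (ha : x i ≠ a) : Connected α i x (Function.update x i a) := by
  refine ⟨1, fun l => l.casesOn x fun _ => Function.update x i a, le_rfl, ?_, rfl, rfl,
    diff_update_of_ne ha, ?_⟩
  · rintro j ⟨r, s, t, hrs, hst, ht, -⟩
    omega
  · intro l hl
    obtain rfl : l = 0 := Nat.lt_one_iff.1 hl
    change diff (Function.update x i a) x ⊆ α x
    rw [diff_comm, diff_update_of_ne ha]
    exact Set.singleton_subset_iff.2 hi

end Connected

section Consistency

variable [DecidableEq N] {x y : Allocation N O}

theorem diff_update_update_subset (x y : Allocation N O) (i : N) (a : O) :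
    diff (Function.update x i a) (Function.update y i a) ⊆ diff x y \ {i} := by
  intro j hj
  have hji : j ≠ i := by
    rintro rfl
    exact hj (by rw [Function.update_self, Function.update_self])
  rw [mem_diff, Function.update_of_ne hji, Function.update_of_ne hji] at hj
  exact ⟨hj, hji⟩

theorem Step.mem_update (hα : IsLocalCompromiserAssignment C α) (hcons : Consistent C α) {a : O}
    (h : Step α P x y) (hi : i ∈ α (Function.update x i a)) : i ∈ α (Function.update y i a) := by
  have hd := diff_update_update_subset x y i a
  have hdα : diff (Function.update x i a) (Function.update y i a) ⊆ α x :=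
    fun j hj => h.diff_subset (hd hj).1
  have hid : i ∉ diff (Function.update x i a) (Function.update y i a) := fun hj => (hd hj).2 rfl
  by_cases hxa : x i = a
  · have hx : Function.update x i a = x := by rw [← hxa, Function.update_eq_self]
    rw [hx] at hi hdα hid
    exact hcons.1 x _ hdα ⟨hi, hid⟩
  by_cases hxC : x ∈ C
  · rwa [← eq_of_reflTransGen_step_of_mem hα hxC (.single h)]
  · have hconn : Connected α i (Function.update x i a) x := by
      have hne : Function.update x i a i ≠ x i := by
        rw [Function.update_self]
        exact Ne.symm hxa
      simpa only [Function.update_idem, Function.update_eq_self] using connected_update hi hne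
    exact hcons.2 i _ x (hα.notMem_of_mem hi) hxC hconn _ hdα hid

theorem mem_update_of_reflTransGen_step (hα : IsLocalCompromiserAssignment C α)
    (hcons : Consistent C α) {a : O} (h : ReflTransGen (Step α P) x y)
    (hi : i ∈ α (Function.update x i a)) : i ∈ α (Function.update y i a) := by
  induction h with
  | refl => exact hi
  | tail _ hs ih => exact hs.mem_update hα hcons ih

theorem mem_update_of_step_of_reflTransGen_step (hα : IsLocalCompromiserAssignment C α)
    (hcons : Consistent C α) {x' : Allocation N O} (hs : Step α P x x')
    (h : ReflTransGen (Step α P) x' y) (hi : i ∈ α y) (hk : k ∈ diff x x') (hki : k ≠ i) (a : O) :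
    k ∈ α (Function.update x i a) := by
  -- Connectedness needs a first step in which `k` moves alone, so her move is split off.
  obtain ⟨hsk, hsx'⟩ := hs.update_left_right hcons.1 k
  have hconn : Connected α k x y := connected_of_step hsk (diff_update_of_ne hk) (.head hsx' h)
  have hd := diff_update_subset x i a
  exact hcons.2 k x y (hα.notMem_of_mem (hs.diff_subset hk)) (hα.notMem_of_mem hi) hconn _
    (hd.trans (Set.singleton_subset_iff.2 hi)) fun hkd => hki (hd hkd)

theorem reflTransGen_step_update (hα : IsLocalCompromiserAssignment C α)
    (hcons : Consistent C α) (hPQ : ∀ j ≠ i, P j = Q j) (h : ReflTransGen (Step α P) x y)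
    (hi : i ∈ α y) (a : O) :
    ReflTransGen (Step α Q) (Function.update x i a) (Function.update y i a) := by
  induction h using ReflTransGen.head_induction_on with
  | refl => exact .refl
  | @head x x' hs hx'y ih =>
    refine .head (fun j hj => ?_) ih
    obtain ⟨hjd, hji⟩ := diff_update_update_subset x x' i a hj
    rw [Function.update_of_ne hji, Function.update_of_ne hji, ← hPQ j hji]
    exact ⟨mem_update_of_step_of_reflTransGen_step hα hcons hs hx'y hi hjd hji a, (hs j hjd).2⟩

end Consistency

section Mechanism

variable [Finite O] {x y : Allocation N O}

theorem step_of_update_eq_some (h : update α P x = some y) : Step α P x y := by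
  classical
  unfold update at h
  split_ifs at h with hne
  obtain rfl := Option.some.inj h
  intro j hj
  have hjα : j ∈ α x := by
    by_contra hjα
    exact hj (by simp only [hjα, dite_false])
  simp only [hjα, dite_true, true_and]
  exact (P j).isBest_argmax _

variable [Nonempty O]

/-- The allocation in which every agent gets her most preferred object: the initial state of the
algorithm. -/
noncomputable def topAllocation (P : Profile N O) : Allocation N O :=
  fun j => (P j).argmax Set.univ Set.univ_nonempty

theorem isBest_topAllocation (P : Profile N O) (j : N) :
    (P j).IsBest Set.univ (topAllocation P j) :=
  (P j).isBest_argmax Set.univ_nonempty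

theorem update_topAllocation [DecidableEq N] (hPQ : ∀ j ≠ i, P j = Q j) :
    Function.update (topAllocation P) i (topAllocation Q i) = topAllocation Q :=
  Function.update_eq_iff.2 ⟨rfl, fun j hj => by rw [topAllocation, topAllocation, hPQ j hj]⟩

theorem reflTransGen_step_of_run_eq_some {t : ℕ} (h : run C α P t = some y) :
    ReflTransGen (Step α P) (topAllocation P) y := by
  induction t generalizing y with
  | zero =>
    obtain rfl := Option.some.inj h
    exact .refl
  | succ t ih =>
    rw [run, Option.bind_eq_some_iff] at h
    obtain ⟨x, hx, hxy⟩ := h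
    split_ifs at hxy with hxC
    · obtain rfl := Option.some.inj hxy
      exact ih hx
    · exact (ih hx).tail (step_of_update_eq_some hxy)

theorem LP_mem (himp : Implementable C α) (P : Profile N O) : LP himp P ∈ C :=
  (himp P).choose_spec.1

theorem reflTransGen_step_LP (himp : Implementable C α) (P : Profile N O) :
    ReflTransGen (Step α P) (topAllocation P) (LP himp P) := by
  obtain ⟨t, ht⟩ := (himp P).choose_spec.2
  exact reflTransGen_step_of_run_eq_some ht

theorem reflTransGen_step_LP_of_reachable (hα : IsLocalCompromiserAssignment C α)
    (hf : ForwardConsistent α) (himp : Implementable C α)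
    (h : ReflTransGen (Step α P) (topAllocation P) x) :
    ReflTransGen (Step α P) x (LP himp P) := by
  obtain ⟨w, hxw, hLPw⟩ := join_reflTransGen_step hf h (reflTransGen_step_LP himp P)
  rwa [eq_of_reflTransGen_step_of_mem hα (LP_mem himp P) hLPw]

theorem eq_LP_of_reachable_of_mem (hα : IsLocalCompromiserAssignment C α)
    (hf : ForwardConsistent α) (himp : Implementable C α)
    (h : ReflTransGen (Step α P) (topAllocation P) x) (hx : x ∈ C) : x = LP himp P :=
  eq_of_reflTransGen_step_of_mem hα hx (reflTransGen_step_LP_of_reachable hα hf himp h)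

theorem LP_apply_ne_of_mem (hα : IsLocalCompromiserAssignment C α) (hcons : Consistent C α)
    (himp : Implementable C α) (hPQ : ∀ j ≠ i, P j = Q j)
    (hx : ReflTransGen (Step α P) (topAllocation P) x) (hi : i ∈ α x) : LP himp Q i ≠ x i := by
  classical
  intro hLPx
  have hfrozen : ReflTransGen (Step α Q) (topAllocation Q)
      (Function.update x i (topAllocation Q i)) := by
    simpa only [update_topAllocation hPQ] using
      reflTransGen_step_update hα hcons hPQ hx hi (topAllocation Q i)
  have hLP := reflTransGen_step_LP_of_reachable hα hcons.1 himp hfrozen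
  have hmem : i ∈ α (Function.update (LP himp Q) i (x i)) :=
    mem_update_of_reflTransGen_step hα hcons hLP
      (by rwa [Function.update_idem, Function.update_eq_self])
  rw [← hLPx, Function.update_eq_self] at hmem
  exact hα.notMem_of_mem hmem (LP_mem himp Q)

theorem LP_strategyProof (hα : IsLocalCompromiserAssignment C α) (hcons : Consistent C α)
    (himp : Implementable C α) (hPQ : ∀ j ≠ i, P j = Q j) :
    (P i).ge (LP himp P i) (LP himp Q i) := by
  refine ((P i).ge_or_gt _ _).resolve_right fun hgt => ?_
  obtain ⟨x, hx, hxi, hi⟩ := exists_mem_of_gt (reflTransGen_step_LP himp P)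
    ((isBest_topAllocation P i).2 _ (Set.mem_univ _)) hgt
  exact LP_apply_ne_of_mem hα hcons himp hPQ hx hi hxi.symm

theorem LP_apply_eq_of_isBest_univ (hα : IsLocalCompromiserAssignment C α)
    (hcons : Consistent C α) (himp : Implementable C α) (hPQ : ∀ j ≠ i, P j = Q j)
    (hbest : (Q i).IsBest Set.univ (LP himp P i)) : LP himp Q i = LP himp P i :=
  (Q i).ge_antisymm (LP_strategyProof hα hcons himp fun j hj => (hPQ j hj).symm)
    (hbest.2 _ (Set.mem_univ _))

theorem LP_eq_LP_of_forall_mem (hα' : IsLocalCompromiserAssignment C α')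
    (hf' : ForwardConsistent α') (himp : Implementable C α) (himp' : Implementable C α')
    (hαα' : ∀ x, ∀ j ≠ i, j ∈ α x → j ∈ α' x) (hbest : (P i).IsBest Set.univ (LP himp P i)) :
    LP himp P = LP himp' P :=
  eq_LP_of_reachable_of_mem hα' hf' himp'
    (reflTransGen_step_of_forall_mem hαα' (reflTransGen_step_LP himp P)
      ((isBest_topAllocation P i).unique hbest))
    (LP_mem himp P)

end Mechanism

end LocalPriority

open LocalPriority

theorem mainTheorem9_general {N O : Type*} [Finite O] [Nonempty O] {C : Set (Allocation N O)}
    {i : N} {α α' : Allocation N O → Set N} (hα : IsLocalCompromiserAssignment C α)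
    (hα' : IsLocalCompromiserAssignment C α') (hcons : Consistent C α) (hcons' : Consistent C α')
    (himp : Implementable C α) (himp' : Implementable C α')
    (hothers : ∀ x, ∀ j ≠ i, j ∈ α x → j ∈ α' x) (P : Profile N O) :
    (P i).ge (LP himp' P i) (LP himp P i) := by
  classical
  obtain ⟨R, hR⟩ := Preference.exists_isBest_univ (LP himp P i)
  let Q : Profile N O := Function.update P i R
  have hPQ : ∀ j ≠ i, P j = Q j := fun j hj => (Function.update_of_ne hj R P).symm
  have hbest : (Q i).IsBest Set.univ (LP himp P i) := by
    rwa [show Q i = R from Function.update_self i R P]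
  have hLP : LP himp Q i = LP himp P i := LP_apply_eq_of_isBest_univ hα hcons himp hPQ hbest
  have hLP' : LP himp Q = LP himp' Q :=
    LP_eq_LP_of_forall_mem hα' hcons'.1 himp himp' hothers (hLP ▸ hbest)
  rw [← hLP, hLP']
  exact LP_strategyProof hα' hcons' himp' hPQ

theorem mainTheorem9 {N O : Type*} [Finite N] [Finite O] [Nonempty O]
    (C : Set (LocalPriority.Allocation N O)) (hC : C.Nonempty) (i : N)
    (α α' : LocalPriority.Allocation N O → Set N)
    (hα : LocalPriority.IsLocalCompromiserAssignment C α)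
    (hα' : LocalPriority.IsLocalCompromiserAssignment C α')
    (hcons : LocalPriority.Consistent C α)
    (hcons' : LocalPriority.Consistent C α')
    (himp : LocalPriority.Implementable C α)
    (himp' : LocalPriority.Implementable C α')
    (hothers : ∀ x, x ∉ C → ∀ j, j ≠ i → j ∈ α x → j ∈ α' x)
    (hself : ∀ x, x ∉ C → i ∈ α' x → i ∈ α x)
    (P : LocalPriority.Profile N O) :
    (P i).ge (LocalPriority.LP himp' P i) (LocalPriority.LP himp P i) :=
  mainTheorem9_general hα hα' hcons hcons' himp himp'
    (fun x j hj hjx => hothers x (hα.notMem_of_mem hjx) j hj hjx) P
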